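/- Let $n \geq 1$ be an integer, let $\langle\cdot,\cdot\rangle$ be the standard inner product on $\mathbb{R}^k$ and $\|\cdot\|$ the Euclidean norm. Let $(M_n,\rho)$ be one of the following two metric spaces: - the hyperbolic space $(H^n(\mathbb{R}), d_h)$, where $H^n(\mathbb{R}) = \mathbb{R}^n$, $d_h(x,y) = \cosh^{-1}\bigl([x][y] - \langle x, y\rangle\bigr)$ and $[x] = \sqrt{1+\|x\|^2}$; - the sphere $(\mathbb{S}^n, d_s)$, where $\mathbb{S}^n = \{x \in \mathbb{R}^{n+1} : \|x\| = 1\}$ and $d_s(x,y) = \frac{1}{\pi}\arccos \langle x, y\rangle$ is the great-circle metric, rescaled so that the sphere has diameter $1$. Then for every metric space $(X,d)$ the following conditions are equivalent: (i) there is a distance-preserving (not necessarily surjective) map from $(X,d)$ into $(M_n,\rho)$; (ii) for every subset $A$ of $X$ with at most $n+3$ points there is a distance-preserving map from $(A, d|_{A\times A})$ into $(M_n,\rho)$. -/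

import Mathlib

noncomputable section

/-! ### The hyperbolic space, with underlying set all of `ℝⁿ` -/

/-- The underlying set of the `n`-dimensional hyperbolic space is `ℝⁿ`; the point with coordinates
`x` stands for the point `(x, √(1 + ‖x‖²))` of the hyperboloid. It is a structure, so that the
Euclidean metric is not inherited. -/
@[ext]
structure HyperbolicSpace (n : ℕ) where
  coords : EuclideanSpace ℝ (Fin n)

/-- The unit sphere of `ℝⁿ⁺¹`. It is a structure, so that the chordal metric is not inherited. -/
@[ext]
structure GreatCircleSphere (n : ℕ) where
  vec : EuclideanSpace ℝ (Fin (n + 1))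
  norm_vec : ‖vec‖ = 1

namespace HyperbolicSpace

variable {n : ℕ}

/-- The height `[x] = √(1 + ‖x‖²)`. -/
def height (x : HyperbolicSpace n) : ℝ := √(1 + ‖x.coords‖ ^ 2)

/-- Minus the Minkowski product: `[x][y] - ⟨x, y⟩`. -/
def lorentz (x y : HyperbolicSpace n) : ℝ :=
  x.height * y.height - inner ℝ x.coords y.coords

/-- The hyperbolic distance `arcosh ([x][y] - ⟨x, y⟩)`. -/
instance : Dist (HyperbolicSpace n) where
  dist x y := Real.arcosh (lorentz x y)

theorem dist_def (x y : HyperbolicSpace n) :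
    dist x y = Real.arcosh (x.height * y.height - inner ℝ x.coords y.coords) := rfl

theorem height_sq (x : HyperbolicSpace n) : x.height ^ 2 = 1 + ‖x.coords‖ ^ 2 :=
  Real.sq_sqrt (by positivity)

theorem height_pos (x : HyperbolicSpace n) : 0 < x.height :=
  Real.sqrt_pos.2 (by positivity)

theorem lorentz_self (x : HyperbolicSpace n) : lorentz x x = 1 := by
  have := x.height_sq
  rw [lorentz, real_inner_self_eq_norm_sq]
  linarith

theorem lorentz_comm (x y : HyperbolicSpace n) : lorentz x y = lorentz y x := by
  rw [lorentz, lorentz, real_inner_comm, mul_comm]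

theorem lorentz_pos (x y : HyperbolicSpace n) : 0 < lorentz x y := by
  have h := real_inner_le_norm x.coords y.coords
  have hx : ‖x.coords‖ < x.height := Real.lt_sqrt_of_sq_lt (by linarith)
  have hy : ‖y.coords‖ < y.height := Real.lt_sqrt_of_sq_lt (by linarith)
  have := mul_lt_mul'' hx hy (norm_nonneg _) (norm_nonneg _)
  rw [lorentz]
  linarith

/-- The image of `x` under the hyperbolic translation that takes `y` to the origin. -/
def translate (y x : HyperbolicSpace n) : EuclideanSpace ℝ (Fin n) :=
  x.coords - (x.height - inner ℝ x.coords y.coords / (y.height + 1)) • y.coords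

theorem inner_translate (y x z : HyperbolicSpace n) :
    inner ℝ (translate y x) (translate y z) = lorentz x y * lorentz y z - lorentz x z := by
  have hb := y.height_pos
  have hy : ‖y.coords‖ ^ 2 = (y.height - 1) * (y.height + 1) := by
    linarith [y.height_sq]
  simp only [translate, lorentz, inner_sub_left, inner_sub_right, real_inner_smul_left,
    real_inner_smul_right, real_inner_self_eq_norm_sq, hy, real_inner_comm z.coords y.coords]
  field_simp
  ring

theorem norm_translate_sq (y x : HyperbolicSpace n) :
    ‖translate y x‖ ^ 2 = lorentz x y ^ 2 - 1 := by
  rw [← real_inner_self_eq_norm_sq, inner_translate, lorentz_self, lorentz_comm y x, sq]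

theorem one_le_lorentz (x y : HyperbolicSpace n) : 1 ≤ lorentz x y := by
  nlinarith [norm_translate_sq y x, sq_nonneg ‖translate y x‖, lorentz_pos x y]

theorem eq_of_lorentz_eq_one {x y : HyperbolicSpace n} (h : lorentz x y = 1) : x = y := by
  have h1 : x.height * y.height = 1 + inner ℝ x.coords y.coords := by
    rw [lorentz] at h
    linarith
  have h2 : (1 + ‖x.coords‖ ^ 2) * (1 + ‖y.coords‖ ^ 2)
      = (1 + inner ℝ x.coords y.coords) ^ 2 := by
    rw [← h1, mul_pow, height_sq, height_sq]
  have h3 := real_inner_mul_inner_self_le x.coords y.coords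
  rw [real_inner_self_eq_norm_sq, real_inner_self_eq_norm_sq] at h3
  have h4 := norm_sub_sq_real x.coords y.coords
  have h5 : ‖x.coords - y.coords‖ ^ 2 ≤ 0 := by nlinarith
  have h6 : ‖x.coords - y.coords‖ = 0 := by nlinarith [norm_nonneg (x.coords - y.coords)]
  exact HyperbolicSpace.ext (sub_eq_zero.1 (norm_eq_zero.1 h6))

theorem norm_translate (y x : HyperbolicSpace n) :
    ‖translate y x‖ = √(lorentz x y ^ 2 - 1) := by
  rw [← norm_translate_sq, Real.sqrt_sq (norm_nonneg _)]

theorem lorentz_triangle (x y z : HyperbolicSpace n) :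
    Real.arcosh (lorentz x z) ≤ Real.arcosh (lorentz x y) + Real.arcosh (lorentz y z) := by
  have hxy := one_le_lorentz x y
  have hyz := one_le_lorentz y z
  have h := neg_le_of_abs_le (abs_real_inner_le_norm (translate y x) (translate y z))
  rw [inner_translate, norm_translate, norm_translate, lorentz_comm z y] at h
  rw [← Real.arcosh_cosh (add_nonneg (Real.arcosh_nonneg hxy) (Real.arcosh_nonneg hyz)),
    Real.arcosh_le_arcosh (lorentz_pos x z) (Real.cosh_pos _), Real.cosh_add,
    Real.cosh_arcosh hxy, Real.cosh_arcosh hyz, Real.sinh_arcosh hxy, Real.sinh_arcosh hyz]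
  linarith

instance : MetricSpace (HyperbolicSpace n) where
  dist_self x := by
    change Real.arcosh (lorentz x x) = 0
    rw [lorentz_self, Real.arcosh_eq_zero_iff le_rfl]
  dist_comm x y := congrArg Real.arcosh (lorentz_comm x y)
  dist_triangle := lorentz_triangle
  eq_of_dist_eq_zero {x y} h :=
    eq_of_lorentz_eq_one ((Real.arcosh_eq_zero_iff (one_le_lorentz x y)).1 h)

end HyperbolicSpace

namespace GreatCircleSphere

variable {n : ℕ}

/-- The great-circle distance, rescaled so that antipodal points have distance `1`. -/
instance : Dist (GreatCircleSphere n) where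
  dist x y := Real.arccos (inner ℝ x.vec y.vec) / Real.pi

theorem dist_def (x y : GreatCircleSphere n) :
    dist x y = Real.arccos (inner ℝ x.vec y.vec) / Real.pi := rfl

theorem dist_eq_angle (x y : GreatCircleSphere n) :
    dist x y = InnerProductGeometry.angle x.vec y.vec / Real.pi := by
  rw [dist_def, InnerProductGeometry.angle, x.norm_vec, y.norm_vec, mul_one, div_one]

instance : MetricSpace (GreatCircleSphere n) where
  dist_self x := by
    rw [dist_def, real_inner_self_eq_norm_sq, x.norm_vec, one_pow, Real.arccos_one, zero_div]
  dist_comm x y := by rw [dist_def, dist_def, real_inner_comm]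
  dist_triangle x y z := by
    rw [dist_eq_angle, dist_eq_angle, dist_eq_angle, ← add_div]
    exact div_le_div_of_nonneg_right (InnerProductGeometry.angle_le_angle_add_angle _ _ _)
      Real.pi_pos.le
  eq_of_dist_eq_zero {x y} h := by
    rw [dist_def, div_eq_zero_iff, or_iff_left Real.pi_ne_zero, Real.arccos_eq_zero] at h
    exact GreatCircleSphere.ext ((inner_eq_one_iff_of_norm_eq_one x.norm_vec y.norm_vec).1
      (le_antisymm ((real_inner_le_norm _ _).trans (by rw [x.norm_vec, y.norm_vec, mul_one])) h))

end GreatCircleSphere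

/-- `X` admits a distance-preserving (not necessarily surjective) map into `M`. -/
def EmbedsIsometrically (X M : Type*) [MetricSpace X] [MetricSpace M] : Prop :=
  ∃ f : X → M, Isometry f

end

/-! Both metrics are encoded by Gram matrices: `cos (π d)` in `ℝⁿ⁺¹` for the sphere; for hyperbolic
space, once a base point `o` is translated to the origin, `cosh d(x,o) cosh d(o,y) - cosh d(x,y)` in
`ℝⁿ`. By `exists_gram_of_finset`, Gram matrices in dimension `N` are detected on `N + 2` points: a
maximal independent finite set `B` has at most `N` points, every other point has coefficients over
`B` forced by the kernel, and `B` with two more points tests each entry. Here `n + 3` is `(n + 1) +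
2` for the sphere and `(n + 2) + 1`, counting `o`, for hyperbolic space. -/

open Finset in
/-- The inner product of two linear combinations only depends on the Gram matrix. -/
theorem inner_sum_smul_eq_of_gram {X E : Type*} [NormedAddCommGroup E] [InnerProductSpace ℝ E]
    {K : X → X → ℝ} {B : Finset X} {f : X → E}
    (hf : ∀ x ∈ B, ∀ y ∈ B, inner ℝ (f x) (f y) = K x y) (c d : X → ℝ) :
    inner ℝ (∑ b ∈ B, c b • f b) (∑ b ∈ B, d b • f b)
      = ∑ a ∈ B, ∑ b ∈ B, c a * (d b * K a b) := by
  rw [sum_inner]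
  refine sum_congr rfl fun a ha => ?_
  rw [inner_sum]
  refine sum_congr rfl fun b hb => ?_
  rw [real_inner_smul_left, real_inner_smul_right, hf a ha b hb]

/-- Linear dependences only depend on the Gram matrix. -/
theorem sum_smul_eq_zero_of_gram {X E F : Type*} [NormedAddCommGroup E] [InnerProductSpace ℝ E]
    [NormedAddCommGroup F] [InnerProductSpace ℝ F]
    {K : X → X → ℝ} {B : Finset X} {f : X → E} {g : X → F}
    (hf : ∀ x ∈ B, ∀ y ∈ B, inner ℝ (f x) (f y) = K x y)
    (hg : ∀ x ∈ B, ∀ y ∈ B, inner ℝ (g x) (g y) = K x y) {c : X → ℝ}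
    (h : ∑ b ∈ B, c b • f b = 0) : ∑ b ∈ B, c b • g b = 0 := by
  rw [← inner_self_eq_zero (𝕜 := ℝ), inner_sum_smul_eq_of_gram hg, ← inner_sum_smul_eq_of_gram hf,
    h, inner_zero_left]

/-- A kernel whose restrictions to all sets of at most `N + 2` points are Gram matrices of vectors
of an `N`-dimensional Euclidean space is itself such a Gram matrix. -/
theorem exists_gram_of_finset {X : Type*} (N : ℕ) (K : X → X → ℝ)
    (h : ∀ A : Finset X, A.card ≤ N + 2 → ∃ f : X → EuclideanSpace ℝ (Fin N),
      ∀ x ∈ A, ∀ y ∈ A, inner ℝ (f x) (f y) = K x y) :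
    ∃ f : X → EuclideanSpace ℝ (Fin N), ∀ x y, inner ℝ (f x) (f y) = K x y := by
  classical
  let P : ℕ → Prop := fun m => ∃ B : Finset X, B.card = m ∧
    ∃ f : X → EuclideanSpace ℝ (Fin N), (∀ x ∈ B, ∀ y ∈ B, inner ℝ (f x) (f y) = K x y) ∧
      LinearIndepOn ℝ f (B : Set X)
  have hP0 : P 0 := ⟨∅, rfl, 0, by simp, by simp⟩
  have hPN : ∀ m, P m → m ≤ N := by
    rintro _ ⟨B, rfl, f, -, hli⟩
    simpa using hli.fintype_card_le_finrank
  obtain ⟨B, hBcard, g, hg, hli⟩ : P (Nat.findGreatest P N) :=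
    Nat.findGreatest_spec (Nat.zero_le N) hP0
  have hBN : B.card ≤ N := hBcard.trans_le (Nat.findGreatest_le N)
  -- The coefficients must not depend on `A` or `f`, so that those of two points can be used in one
  -- common realization.
  have key : ∀ x, ∃ c : X → ℝ, ∀ A : Finset X, insert x B ⊆ A →
      ∀ f : X → EuclideanSpace ℝ (Fin N), (∀ x ∈ A, ∀ y ∈ A, inner ℝ (f x) (f y) = K x y) →
        f x = ∑ b ∈ B, c b • f b := by
    intro x
    by_cases hx : x ∈ B
    · refine ⟨Pi.single x 1, fun A _ f _ => ?_⟩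
      simp [Pi.single_apply, hx]
    have hcard : (insert x B).card = B.card + 1 := Finset.card_insert_of_notMem hx
    obtain ⟨f, hf⟩ := h (insert x B) (by omega)
    have hfB : ∀ x ∈ B, ∀ y ∈ B, inner ℝ (f x) (f y) = K x y := fun a ha b hb =>
      hf a (Finset.mem_insert_of_mem ha) b (Finset.mem_insert_of_mem hb)
    have hfli : LinearIndepOn ℝ f (B : Set X) := by
      rw [linearIndepOn_finset_iff] at hli ⊢
      exact fun c hc => hli c (sum_smul_eq_zero_of_gram hfB hg hc)
    have hspan : f x ∈ Submodule.span ℝ (f '' (B : Set X)) := by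
      -- Otherwise `insert x B` would be a larger independent set, against the maximality of `B`.
      by_contra hns
      have hP : P (B.card + 1) := by
        refine ⟨insert x B, hcard, f, hf, ?_⟩
        rw [Finset.coe_insert]
        exact hfli.insert hns
      have := Nat.le_findGreatest (hPN _ hP) hP
      omega
    obtain ⟨c, hc⟩ := (Submodule.mem_span_image_finset_iff_exists_fun' ℝ).1 hspan
    refine ⟨c, fun A hA f' hf' => ?_⟩
    -- Weight `-1` at `x` turns the expansion of `x` over `B` into a linear dependence, which passes
    -- from `f` to `f'`.
    have hsum : ∀ e : X → EuclideanSpace ℝ (Fin N),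
        ∑ b ∈ insert x B, Function.update c x (-1) b • e b = -e x + ∑ b ∈ B, c b • e b := by
      intro e
      rw [Finset.sum_insert hx, Function.update_self, neg_one_smul]
      congr 1
      refine Finset.sum_congr rfl fun b hb => ?_
      rw [Function.update_of_ne (ne_of_mem_of_not_mem hb hx)]
    have h0 := sum_smul_eq_zero_of_gram (c := Function.update c x (-1)) hf
      (fun a ha b hb => hf' a (hA ha) b (hA hb)) (by rw [hsum, hc, neg_add_cancel])
    rw [hsum] at h0
    exact neg_add_eq_zero.1 h0
  choose c hc using key
  refine ⟨fun x => ∑ b ∈ B, c x b • g b, fun x y => ?_⟩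
  have hcard : (insert x (insert y B)).card ≤ N + 2 :=
    (Finset.card_insert_le _ _).trans
      (Nat.succ_le_succ ((Finset.card_insert_le _ _).trans (Nat.succ_le_succ hBN)))
  obtain ⟨f, hf⟩ := h _ hcard
  rw [← hf x (by simp) y (by simp),
    hc x _ (Finset.insert_subset_insert _ (Finset.subset_insert _ _)) f hf,
    hc y _ (Finset.subset_insert _ _) f hf, inner_sum_smul_eq_of_gram hg]
  exact (inner_sum_smul_eq_of_gram (fun a ha b hb => hf a (by simp [ha]) b (by simp [hb])) _ _).symm

theorem EmbedsIsometrically.finset {X M : Type*} [MetricSpace X] [MetricSpace M]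
    (h : EmbedsIsometrically X M) (A : Finset X) : EmbedsIsometrically A M := by
  obtain ⟨f, hf⟩ := h
  exact ⟨f ∘ Subtype.val, hf.comp isometry_subtype_coe⟩

/-- An isometric embedding of a finite subset, as a function on the whole space. -/
theorem EmbedsIsometrically.exists_dist_eq {X M : Type*} [MetricSpace X] [MetricSpace M]
    [Nonempty M] {A : Finset X} (h : EmbedsIsometrically A M) :
    ∃ f : X → M, ∀ x ∈ A, ∀ y ∈ A, dist (f x) (f y) = dist x y := by
  classical
  obtain ⟨f, hf⟩ := h
  refine ⟨fun x => if hx : x ∈ A then f ⟨x, hx⟩ else Classical.arbitrary M, fun x hx y hy => ?_⟩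
  simp only [dif_pos hx, dif_pos hy]
  exact hf.dist_eq _ _

instance (n : ℕ) : Nonempty (HyperbolicSpace n) := ⟨⟨0⟩⟩

instance (n : ℕ) : Nonempty (GreatCircleSphere n) :=
  ⟨⟨EuclideanSpace.single 0 1, by simp⟩⟩

theorem HyperbolicSpace.cosh_dist {n : ℕ} (x y : HyperbolicSpace n) :
    Real.cosh (dist x y) = lorentz x y :=
  Real.cosh_arcosh (one_le_lorentz x y)

theorem HyperbolicSpace.embedsIsometrically_of_finset {n : ℕ} {X : Type*} [MetricSpace X]
    (h : ∀ A : Finset X, A.card ≤ n + 3 → EmbedsIsometrically A (HyperbolicSpace n)) :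
    EmbedsIsometrically X (HyperbolicSpace n) := by
  classical
  rcases isEmpty_or_nonempty X with hX | ⟨⟨o⟩⟩
  · exact ⟨isEmptyElim, fun x => isEmptyElim x⟩
  obtain ⟨v, hv⟩ := exists_gram_of_finset n
    (fun x y : X => Real.cosh (dist x o) * Real.cosh (dist o y) - Real.cosh (dist x y)) (by
      intro A hA
      obtain ⟨f, hf⟩ := (h (insert o A)
        ((Finset.card_insert_le _ _).trans (Nat.succ_le_succ hA))).exists_dist_eq
      refine ⟨fun x => translate (f o) (f x), fun x hx y hy => ?_⟩
      have ho := Finset.mem_insert_self o A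
      replace hx := Finset.mem_insert_of_mem (b := o) hx
      replace hy := Finset.mem_insert_of_mem (b := o) hy
      rw [inner_translate, ← cosh_dist, ← cosh_dist, ← cosh_dist, hf x hx o ho, hf o ho y hy,
        hf x hx y hy])
  -- The diagonal of the kernel is `cosh² d(x,o) - 1`.
  have hheight : ∀ x, height ⟨v x⟩ = Real.cosh (dist x o) := by
    intro x
    rw [height, ← real_inner_self_eq_norm_sq, hv, dist_self, Real.cosh_zero, dist_comm o x,
      add_sub_cancel, Real.sqrt_mul_self (Real.cosh_pos _).le]
  refine ⟨fun x => ⟨v x⟩, Isometry.of_dist_eq fun x y => ?_⟩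
  rw [dist_def, hheight, hheight, hv, dist_comm o y, sub_sub_cancel,
    Real.arcosh_cosh dist_nonneg]

theorem GreatCircleSphere.cos_pi_mul_dist {n : ℕ} (x y : GreatCircleSphere n) :
    Real.cos (Real.pi * dist x y) = inner ℝ x.vec y.vec := by
  have h := abs_le.1 (abs_real_inner_le_norm x.vec y.vec)
  rw [x.norm_vec, y.norm_vec, mul_one] at h
  rw [dist_def, mul_div_cancel₀ _ Real.pi_ne_zero, Real.cos_arccos h.1 h.2]

theorem GreatCircleSphere.dist_le_one {n : ℕ} (x y : GreatCircleSphere n) : dist x y ≤ 1 :=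
  div_le_one_of_le₀ (Real.arccos_le_pi _) Real.pi_pos.le

theorem GreatCircleSphere.embedsIsometrically_of_finset {n : ℕ} {X : Type*} [MetricSpace X]
    (h : ∀ A : Finset X, A.card ≤ n + 3 → EmbedsIsometrically A (GreatCircleSphere n)) :
    EmbedsIsometrically X (GreatCircleSphere n) := by
  classical
  obtain ⟨v, hv⟩ := exists_gram_of_finset (n + 1)
    (fun x y : X => Real.cos (Real.pi * dist x y)) (by
      intro A hA
      obtain ⟨f, hf⟩ := (h A hA).exists_dist_eq
      refine ⟨fun x => (f x).vec, fun x hx y hy => ?_⟩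
      rw [← cos_pi_mul_dist, hf x hx y hy])
  -- The cosine determines `π d` only within `[0, π]`; two-point subsets give this bound.
  have hdist : ∀ x y : X, dist x y ≤ 1 := by
    intro x y
    obtain ⟨f, hf⟩ := (h {x, y} (Finset.card_le_two.trans (by omega))).exists_dist_eq
    rw [← hf x (by simp) y (by simp)]
    exact dist_le_one _ _
  have hnorm : ∀ x, ‖v x‖ = 1 := by
    intro x
    rw [norm_eq_sqrt_real_inner, hv, dist_self, mul_zero, Real.cos_zero, Real.sqrt_one]
  refine ⟨fun x => ⟨v x, hnorm x⟩, Isometry.of_dist_eq fun x y => ?_⟩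
  rw [dist_def, hv, Real.arccos_cos (mul_nonneg Real.pi_pos.le dist_nonneg)
    (mul_le_of_le_one_right Real.pi_pos.le (hdist x y)), mul_div_cancel_left₀ _ Real.pi_ne_zero]

theorem mainTheorem11 (n : ℕ) (hn : 0 < n) (X : Type*) [MetricSpace X] :
    (EmbedsIsometrically X (HyperbolicSpace n) ↔
      ∀ A : Finset X, A.card ≤ n + 3 → EmbedsIsometrically A (HyperbolicSpace n)) ∧
    (EmbedsIsometrically X (GreatCircleSphere n) ↔
      ∀ A : Finset X, A.card ≤ n + 3 → EmbedsIsometrically A (GreatCircleSphere n)) :=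
  ⟨⟨fun h A _ => h.finset A, HyperbolicSpace.embedsIsometrically_of_finset⟩,
    ⟨fun h A _ => h.finset A, GreatCircleSphere.embedsIsometrically_of_finset⟩⟩
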